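/- Let $(V,q)$ be a finite-dimensional positive definite quadratic space over $\mathbb{Q}$ with associated bilinear form $b(x,y)=q(x+y)-q(x)-q(y)$, and let $M$ be a $\mathbb{Z}$-lattice of full rank in $V$ with $q(M)\subseteq\mathbb{Z}$ which is unimodular with respect to $b$, i.e. $\{x\in V : b(x,M)\subseteq\mathbb{Z}\}=M$. Let $\sigma$ be an isometry of $(V,q)$ with $\sigma(M)=M$, of odd prime order $p$, let $V_0=\{x\in V:\sigma x=x\}$ be its fixed space, and assume $m_0=\dim V_0\ge 1$. For $\mathbf{x}=(x_1,\dots,x_{m_0})\in M^{m_0}$ put $q(\mathbf{x})=\tfrac12\,(b(x_i,x_j))_{i,j}$, and let, for $Z$ in the Siegel upper half space of degree $m_0$, $$F_M(Z)=\sum_{\mathbf{x}\in M^{m_0}}\exp(2\pi i\,\mathrm{tr}(q(\mathbf{x})Z))=\sum_{T}A(M,T)\exp(2\pi i\,\mathrm{tr}(TZ))$$ be the degree $m_0$ theta series of $M$, where $T$ runs over the half-integral symmetric $m_0\times m_0$ matrices ($t_{ii}\in\mathbb{Z}$, $2t_{ij}\in\mathbb{Z}$) and $A(M,T)=\#\{\mathbf{x}\in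 M^{m_0}: q(\mathbf{x})=T\}<\infty$; both series converge absolutely. Then for every such $T$ $$\det(T)\,A(M,T)\in p\,\mathbb{Z}_{(p)},$$ where $\mathbb{Z}_{(p)}$ is the localization of $\mathbb{Z}$ at $p$, unless $M$ is decomposable (an orthogonal sum of proper sublattices) and has a proper orthogonal summand of rank $m_0$. In particular, $\det(T)\,A(M,T)\in p\,\mathbb{Z}_{(p)}$ holds for all $T$ whenever $m_0$ is not divisible by $8$. -/

import Mathlib

noncomputable section

namespace SiegelTheta

/-! ### Lattices in a rational quadratic space

The bilinear form attached to `Q` is `b x y = Q (x + y) - Q x - Q y`, that is `QuadraticMap.polar Q`.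
A lattice of full rank on `V` is a `ℤ`-submodule `M` with `Submodule.IsLattice ℚ M`. -/

section Lattices

variable {V : Type*} [AddCommGroup V] [Module ℚ V]

/-- `M` is `Q`-integral: `Q` takes integral values on `M`. -/
def IsIntegral (Q : QuadraticForm ℚ V) (M : Submodule ℤ V) : Prop :=
  ∀ x ∈ M, ∃ k : ℤ, Q x = k

/-- `M` is unimodular with respect to `b`: the dual lattice `{x | b(x, M) ⊆ ℤ}` equals `M`. -/
def IsUnimodular (Q : QuadraticForm ℚ V) (M : Submodule ℤ V) : Prop :=
  LinearMap.BilinForm.dualSubmodule (QuadraticMap.polarBilin Q) M = M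

/-- The group `O(M, Q)` of isometries of `(V, Q)` that map `M` onto itself. -/
def latticeIsometryGroup (Q : QuadraticForm ℚ V) (M : Submodule ℤ V) :
    Subgroup (V ≃ₗ[ℚ] V) where
  carrier := {σ | (∀ x, Q (σ x) = Q x) ∧ ∀ x, σ x ∈ M ↔ x ∈ M}
  mul_mem' := by
    rintro σ τ ⟨h1, h2⟩ ⟨h3, h4⟩
    exact ⟨fun x => by rw [LinearEquiv.mul_apply, h1, h3],
      fun x => by rw [LinearEquiv.mul_apply, h2, h4]⟩
  one_mem' := ⟨fun _ => rfl, fun _ => Iff.rfl⟩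
  inv_mem' := by
    rintro σ ⟨h1, h2⟩
    have h : ∀ x, σ (σ⁻¹ x) = x := fun x => σ.apply_symm_apply x
    exact ⟨fun x => by rw [← h1, h], fun x => by rw [← h2, h]⟩

/-- The fixed space `V₀ = {x | σ x = x}` of `σ` in `V`. -/
def fixedSpace (σ : V ≃ₗ[ℚ] V) : Submodule ℚ V :=
  LinearMap.fixedSubmodule (σ : V →ₗ[ℚ] V)

/-- `M` is the orthogonal sum `L ⊥ L'` of the sublattices `L` and `L'`. -/
structure IsOrthogonalSum (Q : QuadraticForm ℚ V) (M L L' : Submodule ℤ V) : Prop where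
  sup_eq : L ⊔ L' = M
  disjoint : Disjoint L L'
  orthogonal : ∀ x ∈ L, ∀ y ∈ L', QuadraticMap.polar Q x y = 0

/-- `M` is decomposable: it is an orthogonal sum of proper sublattices. -/
def IsDecomposable (Q : QuadraticForm ℚ V) (M : Submodule ℤ V) : Prop :=
  ∃ L L' : Submodule ℤ V, IsOrthogonalSum Q M L L' ∧ L ≠ M ∧ L' ≠ M

/-- `M` has a proper orthogonal summand of rank `r`. -/
def HasProperOrthogonalSummand (Q : QuadraticForm ℚ V) (M : Submodule ℤ V) (r : ℕ) : Prop :=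
  ∃ L L' : Submodule ℤ V, IsOrthogonalSum Q M L L' ∧ L ≠ M ∧ Module.finrank ℤ L = r

/-- The matrix `Q(x) = (1/2) (b(x_i, x_j))` of a tuple `x = (x_1, …, x_n)` of vectors. -/
def halfGram (Q : QuadraticForm ℚ V) {n : ℕ} (x : Fin n → V) : Matrix (Fin n) (Fin n) ℚ :=
  Matrix.of fun i j => QuadraticMap.polar Q (x i) (x j) / 2

end Lattices

/-! ### Siegel theta series and their Fourier expansions -/

/-- The Siegel upper half space of degree `n`. -/
def siegelUpperHalfSpace (n : ℕ) : Set (Matrix (Fin n) (Fin n) ℂ) :=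
  {Z | Z.IsSymm ∧ (Z.map Complex.im).PosDef}

/-- The half-integral symmetric matrices: symmetric rational matrices `T` with `T i i ∈ ℤ` and
`2 * T i j ∈ ℤ`. They index the Fourier expansions of degree `n`. -/
def HalfIntegralMatrix (n : ℕ) : Type :=
  {T : Matrix (Fin n) (Fin n) ℚ //
    T.IsSymm ∧ (∀ i, ∃ k : ℤ, T i i = k) ∧ ∀ i j, ∃ k : ℤ, 2 * T i j = k}

/-- The exponential `exp (2 π i tr(T Z))`. -/
def expTrace {n : ℕ} (T : Matrix (Fin n) (Fin n) ℚ) (Z : Matrix (Fin n) (Fin n) ℂ) : ℂ :=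
  Complex.exp (2 * Real.pi * Complex.I * (T.map (fun q : ℚ => (q : ℂ)) * Z).trace)

/-- The degree `n` theta series `F_M(Z) = ∑_{x ∈ M^n} exp (2 π i tr(Q(x) Z))`. -/
def thetaSeries {V : Type*} [AddCommGroup V] [Module ℚ V] (Q : QuadraticForm ℚ V)
    (M : Submodule ℤ V) (n : ℕ) (Z : Matrix (Fin n) (Fin n) ℂ) : ℂ :=
  ∑' x : Fin n → M, expTrace (halfGram Q fun i => (x i : V)) Z

/-- The set of tuples `x ∈ M^n` with `Q(x) = T`. -/
def representations {V : Type*} [AddCommGroup V] [Module ℚ V] (Q : QuadraticForm ℚ V)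
    (M : Submodule ℤ V) {n : ℕ} (T : HalfIntegralMatrix n) : Set (Fin n → M) :=
  {x | halfGram Q (fun i => (x i : V)) = T.1}

/-- `A(M, T)`, the number of `x ∈ M^n` with `Q(x) = T`. -/
def thetaCoeff {V : Type*} [AddCommGroup V] [Module ℚ V] (Q : QuadraticForm ℚ V)
    (M : Submodule ℤ V) {n : ℕ} (T : HalfIntegralMatrix n) : ℚ :=
  ((representations Q M T).ncard : ℚ)

/-- `f(Z) = ∑_T a(T) exp (2 π i tr(T Z))`, convergent absolutely on the Siegel upper half space. -/
def HasFourierExpansion {n : ℕ} (f : Matrix (Fin n) (Fin n) ℂ → ℂ)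
    (a : HalfIntegralMatrix n → ℚ) : Prop :=
  ∀ Z ∈ siegelUpperHalfSpace n, HasSum (fun T => (a T : ℂ) * expTrace T.1 Z) (f Z)

/-- The theta operator on Fourier expansions, `∑_T a(T) e(tr(TZ)) ↦ ∑_T det(T) a(T) e(tr(TZ))`,
in terms of the coefficients. -/
def thetaOperator {n : ℕ} (a : HalfIntegralMatrix n → ℚ) : HalfIntegralMatrix n → ℚ :=
  fun T => T.1.det * a T

/-- The maximal ideal `p ℤ_(p)` of the localization `ℤ_(p) ⊆ ℚ`, as a set of rational numbers. -/
def maximalIdealAt (p : ℕ) : Set ℚ :=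
  {r | ∃ k d : ℤ, ¬ (p : ℤ) ∣ d ∧ r = (p : ℚ) * (k / d)}

/-- A Fourier expansion is `≡ 0 mod p`: all its coefficients lie in `p ℤ_(p)`. -/
def CongruentZeroMod {n : ℕ} (p : ℕ) (a : HalfIntegralMatrix n → ℚ) : Prop :=
  ∀ T, a T ∈ maximalIdealAt p

end SiegelTheta

end

/-!
The isometry `σ` of order `p` permutes the set of representations of `T` by tuples of vectors of
`M`, so `p ∣ A(M, T)` unless some representation `x` consists of vectors of the fixed lattice
`M ∩ V₀`. In that case `2T` is the Gram matrix of the `m₀ = dim V₀` vectors `x i`. If `p` does not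
divide `det (2T)`, the `x i` form a basis of `V₀`, and the orthogonal projection `π m` to `V₀` of a
vector `m ∈ M` satisfies both `p π(m) = ∑ σ^i m ∈ M` and, by Cramer's rule, `det(2T) π(m) ∈ M`;
hence `π m ∈ M` (`projectsToFixedLattice_of_not_dvd_det`). So the failure of the congruence forces
`M = (M ∩ V₀) ⊥ (M ∩ V₀^⊥)`, where the first summand has rank `m₀`, and both summands are proper
because `σ ≠ 1` and `m₀ ≥ 1`.

If moreover `M` is unimodular, so is the even lattice `M ∩ V₀`, whence `8 ∣ m₀`
(`eight_dvd_finrank`). The latter theorem is proved by Gauss sums. Let `e` be an orthogonal basis of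
`V` inside an even unimodular lattice `L`, with `Q (e i) = a i`. The sum of `exp (2 π i Q)` over the
discriminant group of the sublattice spanned by `e` is the index of this sublattice, because the
image of `L` in the discriminant group is isotropic and is its own orthogonal complement
(`sum_eq_card_of_translation`). On the other hand it is the product of the classical sums
`∑ exp (π i r² / (2 a))`, each of which equals `√(2a) exp (π i / 4)` (`sum_exp_sq_div_two_mul`).
Comparing arguments gives `exp (π i rank(L) / 4) = 1`. The value of the classical sum comes from the
behaviour of Jacobi's theta constant at the cusp `1 / (2a)`, computed once by splitting the series
into residue classes and once by the inversion formula.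

Convergence of the theta series also uses an orthogonal basis `e` inside `M`: the pairings with `e`
embed `M` into `ℤ^N`, and in these coordinates the absolute value of the general term is bounded by
a Gaussian. Finiteness of the sets of representations follows from convergence at `Z = i`.
-/

/-! ### The quadratic Gauss sum -/

section GaussSum

open Filter Topology HurwitzZeta

/-- Inversion of the theta constant, `θ(τ) = (-iτ)^(-1/2) θ(-1/τ)`. -/
theorem jacobiTheta_eq_one_div_mul (τ : ℂ) :
    jacobiTheta τ = 1 / (-Complex.I * τ) ^ (1 / 2 : ℂ) * jacobiTheta (-1 / τ) := by
  simpa [jacobiTheta_eq_jacobiTheta₂] using jacobiTheta₂_functional_equation 0 τ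

theorem jacobiTheta_add_two_mul_nat (τ : ℂ) (a : ℕ) :
    jacobiTheta (τ + 2 * a) = jacobiTheta τ := by
  induction a with
  | zero => simp
  | succ a ih =>
    rw [← ih, ← jacobiTheta_two_add (τ + 2 * a)]
    congr 1
    push_cast
    ring

theorem tendsto_cosKernel_atTop (a : UnitAddCircle) : Tendsto (cosKernel a) atTop (𝓝 1) := by
  obtain ⟨c, hc, h⟩ := isBigO_atTop_cosKernel_sub a
  have h0 : Tendsto (fun x : ℝ => Real.exp (-c * x)) atTop (𝓝 0) :=
    Real.tendsto_exp_atBot.comp (tendsto_id.const_mul_atTop_of_neg (neg_lt_zero.mpr hc))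
  simpa using (h.trans_tendsto h0).add_const 1

theorem tendsto_jacobiTheta_comap_im_atTop :
    Tendsto jacobiTheta (comap Complex.im atTop) (𝓝 1) := by
  have h0 : Tendsto (fun τ : ℂ => Real.exp (-Real.pi * τ.im)) (comap Complex.im atTop) (𝓝 0) :=
    Real.tendsto_exp_atBot.comp
      (tendsto_comap.const_mul_atTop_of_neg (neg_lt_zero.mpr Real.pi_pos))
  simpa using (isBigO_at_im_infty_jacobiTheta_sub_one.trans_tendsto h0).add_const 1

theorem Complex.ofReal_mul_cpow {r : ℝ} (hr : 0 < r) {z : ℂ} (hz : z ≠ 0) (c : ℂ) :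
    ((r : ℂ) * z) ^ c = (r : ℂ) ^ c * z ^ c := by
  have hr' : (r : ℂ) ≠ 0 := Complex.ofReal_ne_zero.mpr hr.ne'
  rw [Complex.cpow_def_of_ne_zero (mul_ne_zero hr' hz), Complex.cpow_def_of_ne_zero hr',
    Complex.cpow_def_of_ne_zero hz, Complex.log_ofReal_mul hr hz, ← Complex.exp_add,
    Complex.ofReal_log hr.le, add_mul]

/-- Splitting the theta constant at `1 / (2a) + i t / (4a²)` according to residues modulo `2a`:
`exp (π i n² / (2a))` depends only on `n` modulo `2a`. -/
theorem jacobiTheta_eq_sum_evenKernel {a : ℕ} (ha : 0 < a) {t : ℝ} (ht : 0 < t) :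
    jacobiTheta (1 / (2 * a) + Complex.I * t / (4 * a ^ 2)) =
      ∑ r : Fin (2 * a), Complex.exp (Real.pi * Complex.I * r ^ 2 / (2 * a)) *
        evenKernel (((r : ℝ) / (2 * a) : ℝ) : UnitAddCircle) t := by
  have : NeZero (2 * a) := ⟨by omega⟩
  have ha' : (a : ℂ) ≠ 0 := by exact_mod_cast ha.ne'
  have har : (0 : ℝ) < a := by exact_mod_cast ha
  set τ : ℂ := 1 / (2 * a) + Complex.I * t / (4 * a ^ 2) with hτ
  have hτ' : τ = ((1 / (2 * a) : ℝ) : ℂ) + ((t / (4 * a ^ 2) : ℝ) : ℂ) * Complex.I := by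
    rw [hτ]; push_cast; ring
  have him : 0 < τ.im := by
    rw [hτ', Complex.add_im, Complex.ofReal_im, Complex.im_ofReal_mul, Complex.I_im]
    positivity
  have hs := hasSum_jacobiTheta₂_term 0 him
  rw [← jacobiTheta_eq_jacobiTheta₂] at hs
  have hs' := (Equiv.prodComm _ _).hasSum_iff.mpr
    ((Int.divModEquiv (2 * a)).symm.hasSum_iff.mpr hs)
  refine (hs'.prod_fiberwise fun r => ?_).unique (hasSum_fintype _)
  have hk := (Complex.hasSum_ofReal.mpr (hasSum_int_evenKernel ((r : ℝ) / (2 * a)) ht)).mul_left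
    (Complex.exp (Real.pi * Complex.I * r ^ 2 / (2 * a)))
  refine Eq.mp (congrArg (HasSum · _) (funext fun q => ?_)) hk
  symm
  change jacobiTheta₂_term (q * ((2 * a : ℕ) : ℤ) + ((r : ℕ) : ℤ)) 0 τ = _
  rw [jacobiTheta₂_term, Complex.ofReal_exp, ← Complex.exp_add, Complex.exp_eq_exp_iff_exists_int]
  -- `(2aq + r)² / (2a) = r² / (2a) + 2 (a q² + q r)`
  refine ⟨a * q ^ 2 + q * r, ?_⟩
  rw [hτ]
  push_cast
  field_simp
  linear_combination (4 * t * (q * 2 * a + r) ^ 2 : ℂ) * Complex.I_sq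

/-- The quadratic Gauss sum `∑ exp (π i r² / (2a))` over `r` modulo `2a`, obtained by comparing two
expressions for the behaviour of the theta constant at the cusp `1 / (2a)`. -/
theorem sum_exp_sq_div_two_mul {a : ℕ} (ha : 0 < a) :
    ∑ r : Fin (2 * a), Complex.exp (Real.pi * Complex.I * r ^ 2 / (2 * a)) =
      Real.sqrt (2 * a) * Complex.exp (Real.pi * Complex.I / 4) := by
  have ha' : (a : ℂ) ≠ 0 := by exact_mod_cast ha.ne'
  have har : (0 : ℝ) < a := by exact_mod_cast ha
  set τ : ℝ → ℂ := fun t => 1 / (2 * a) + Complex.I * t / (4 * a ^ 2) with hτ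
  set u : ℝ → ℂ := fun t => 1 / (1 + Complex.I * t / (2 * a)) with hu
  have hden : ∀ t : ℝ, 1 + Complex.I * t / (2 * a) ≠ 0 := fun t h => by
    have h1 : (1 : ℂ) + ((t / (2 * a) : ℝ) : ℂ) * Complex.I = 0 := by
      rw [← h]; push_cast; ring
    have := congrArg Complex.re h1
    rw [Complex.add_re, Complex.re_ofReal_mul] at this
    simp at this
  have hτ0 : -Complex.I * τ 0 = ((1 / (2 * a) : ℝ) : ℂ) * (-Complex.I) := by
    rw [hτ]; push_cast; ring
  have hu0 : u 0 = 1 := by rw [hu]; simp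
  -- the residue-class decomposition, as `t → 0`
  have h1 : Tendsto (fun t : ℝ => ((t ^ (1 / 2 : ℝ) : ℝ) : ℂ) * jacobiTheta (τ t)) (𝓝[>] 0)
      (𝓝 (∑ r : Fin (2 * a), Complex.exp (Real.pi * Complex.I * r ^ 2 / (2 * a)) * (1 : ℝ))) := by
    have hlim : Tendsto (fun t : ℝ => ∑ r : Fin (2 * a),
        Complex.exp (Real.pi * Complex.I * r ^ 2 / (2 * a)) *
          ((cosKernel (((r : ℝ) / (2 * a) : ℝ) : UnitAddCircle) (1 / t) : ℝ) : ℂ)) (𝓝[>] 0)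
        (𝓝 (∑ r : Fin (2 * a),
          Complex.exp (Real.pi * Complex.I * r ^ 2 / (2 * a)) * (1 : ℝ))) := by
      refine tendsto_finsetSum _ fun r _ => Tendsto.const_mul _ ?_
      refine (Complex.continuous_ofReal.tendsto 1).comp ((tendsto_cosKernel_atTop _).comp
        (f := fun t => 1 / t) ?_)
      simpa only [one_div] using tendsto_inv_nhdsGT_zero (𝕜 := ℝ)
    refine hlim.congr' (eventually_nhdsWithin_of_forall fun t ht => ?_)
    have ht' : (0 : ℝ) < t ^ (1 / 2 : ℝ) := Real.rpow_pos_of_pos ht _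
    change _ = ((t ^ (1 / 2 : ℝ) : ℝ) : ℂ) *
      jacobiTheta (1 / (2 * a) + Complex.I * t / (4 * a ^ 2))
    rw [jacobiTheta_eq_sum_evenKernel ha ht, Finset.mul_sum]
    refine Finset.sum_congr rfl fun r _ => ?_
    rw [mul_left_comm, evenKernel_functional_equation, ← Complex.ofReal_mul]
    congr 2
    field_simp
  -- two inversions and a translation, as `t → 0`
  have h2 : Tendsto (fun t : ℝ => ((t ^ (1 / 2 : ℝ) : ℝ) : ℂ) * jacobiTheta (τ t)) (𝓝[>] 0)
      (𝓝 (1 / (-Complex.I * τ 0) ^ (1 / 2 : ℂ) * (1 / (u 0) ^ (1 / 2 : ℂ)) * 1)) := by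
    have hcτ : Continuous τ := by rw [hτ]; fun_prop
    have hcu : Continuous u := by
      rw [hu]
      exact continuous_const.div (by fun_prop) hden
    have hτs : -Complex.I * τ 0 ∈ Complex.slitPlane := by
      rw [hτ0, Complex.mem_slitPlane_iff]
      right
      rw [Complex.im_ofReal_mul]
      simp [ha.ne']
    have l1 : Tendsto (fun t => 1 / (-Complex.I * τ t) ^ (1 / 2 : ℂ)) (𝓝[>] 0)
        (𝓝 (1 / (-Complex.I * τ 0) ^ (1 / 2 : ℂ))) := by
      refine tendsto_const_nhds.div (Tendsto.mono_left ?_ nhdsWithin_le_nhds) ?_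
      · exact ((continuous_const.mul hcτ).tendsto 0).cpow tendsto_const_nhds hτs
      · rw [Ne, Complex.cpow_eq_zero_iff]
        exact fun h => Complex.slitPlane_ne_zero hτs h.1
    have l2 : Tendsto (fun t => 1 / (u t) ^ (1 / 2 : ℂ)) (𝓝[>] 0)
        (𝓝 (1 / (u 0) ^ (1 / 2 : ℂ))) := by
      refine tendsto_const_nhds.div (Tendsto.mono_left ?_ nhdsWithin_le_nhds) ?_
      · exact (hcu.tendsto 0).cpow tendsto_const_nhds (by rw [hu0]; exact Complex.one_mem_slitPlane)
      · rw [hu0]; simp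
    have l3 : Tendsto (fun t : ℝ => jacobiTheta (Complex.I / t - 1 / (2 * a))) (𝓝[>] 0)
        (𝓝 1) := by
      refine tendsto_jacobiTheta_comap_im_atTop.comp (tendsto_comap_iff.mpr ?_)
      refine (tendsto_inv_nhdsGT_zero (𝕜 := ℝ)).congr fun t => ?_
      have : Complex.I / t - 1 / (2 * a) =
          ((t⁻¹ : ℝ) : ℂ) * Complex.I - ((1 / (2 * a) : ℝ) : ℂ) := by push_cast; ring
      rw [Function.comp_apply, this, Complex.sub_im, Complex.ofReal_im, Complex.im_ofReal_mul]
      simp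
    refine ((l1.mul l2).mul l3).congr' (eventually_nhdsWithin_of_forall fun t (ht : 0 < t) => ?_)
    have htc : (t : ℂ) ≠ 0 := by exact_mod_cast ht.ne'
    have hne : (1 + Complex.I * t / (2 * a)) ≠ 0 := hden t
    have hne' : (2 * a + Complex.I * t : ℂ) ≠ 0 := fun h => hne (by
      field_simp
      linear_combination h)
    have e1 : -1 / τ t + 2 * a = Complex.I * t * u t := by
      have hτt : τ t = (2 * a + Complex.I * t) / (4 * a ^ 2) := by
        simp only [hτ]
        field_simp
        ring
      have hut : u t = 2 * a / (2 * a + Complex.I * t) := by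
        simp only [hu]
        field_simp
      rw [hτt, hut]
      field_simp
      ring
    have e2 : -1 / (Complex.I * t * u t) = Complex.I / t - 1 / (2 * a) := by
      rw [hu]
      field_simp
      linear_combination (-(2 * a : ℂ)) * Complex.I_sq
    have e3 : -Complex.I * (Complex.I * t * u t) = t * u t := by
      linear_combination (-(t * u t)) * Complex.I_sq
    change _ = ((t ^ (1 / 2 : ℝ) : ℝ) : ℂ) * jacobiTheta (τ t)
    rw [jacobiTheta_eq_one_div_mul (τ t), ← jacobiTheta_add_two_mul_nat (-1 / τ t) a, e1,
      jacobiTheta_eq_one_div_mul (Complex.I * t * u t), e2, e3,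
      Complex.ofReal_mul_cpow ht (z := u t) (one_div_ne_zero hne), Complex.ofReal_cpow ht.le]
    have htr : (t : ℂ) ^ (1 / 2 : ℂ) ≠ 0 := by simp [htc]
    have hcast : ((1 / 2 : ℝ) : ℂ) = 1 / 2 := by push_cast; rfl
    rw [hcast]
    generalize u t ^ (1 / 2 : ℂ) = v
    generalize (t : ℂ) ^ (1 / 2 : ℂ) = w at htr
    field_simp
  have h3 := tendsto_nhds_unique h1 h2
  simp only [Complex.ofReal_one, mul_one] at h3
  have hI : (-Complex.I) ^ (1 / 2 : ℂ) = (Complex.exp (Real.pi * Complex.I / 4))⁻¹ := by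
    rw [Complex.cpow_def_of_ne_zero (neg_ne_zero.mpr Complex.I_ne_zero), Complex.log_neg_I,
      ← Complex.exp_neg]
    congr 1
    ring
  have hr : ((1 / (2 * a) : ℝ) : ℂ) ^ (1 / 2 : ℂ) = ((Real.sqrt (2 * a) : ℝ) : ℂ)⁻¹ := by
    rw [← Complex.ofReal_inv, ← Real.sqrt_inv, Real.sqrt_eq_rpow,
      Complex.ofReal_cpow (by positivity)]
    norm_num
  rw [h3, hτ0, hu0, Complex.ofReal_mul_cpow (by positivity) (neg_ne_zero.mpr Complex.I_ne_zero),
    hI, hr]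
  simp [mul_comm]

end GaussSum

namespace SiegelTheta

/-! ### Orthogonal frames in an integral lattice -/

section Frames

variable {V : Type*} [AddCommGroup V] [Module ℚ V]

theorem exists_int_smul_mem {M : Submodule ℤ V} (hM : Submodule.span ℚ (M : Set V) = ⊤) (x : V) :
    ∃ n : ℤ, n ≠ 0 ∧ n • x ∈ M := by
  obtain ⟨t, ht⟩ := multiple_mem_span_of_mem_localization_span (nonZeroDivisors ℤ) ℚ (M : Set V) x
    (hM ▸ Submodule.mem_top)
  exact ⟨t, nonZeroDivisors.ne_zero t.2, by rwa [Submodule.span_eq] at ht⟩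

theorem IsIntegral.exists_polar_eq {Q : QuadraticForm ℚ V} {M : Submodule ℤ V}
    (h : IsIntegral Q M) {x y : V} (hx : x ∈ M) (hy : y ∈ M) :
    ∃ k : ℤ, QuadraticMap.polar Q x y = k := by
  obtain ⟨a, ha⟩ := h _ (M.add_mem hx hy)
  obtain ⟨b, hb⟩ := h _ hx
  obtain ⟨c, hc⟩ := h _ hy
  exact ⟨a - b - c, by rw [QuadraticMap.polar, ha, hb, hc]; push_cast; rfl⟩

/-- An orthogonal basis of `V` consisting of vectors of the lattice `M`, together with the positive
integers `norm i = Q (basis i)`. -/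
structure OrthogonalFrame (Q : QuadraticForm ℚ V) (M : Submodule ℤ V) where
  basis : Module.Basis (Fin (Module.finrank ℚ V)) ℚ V
  norm : Fin (Module.finrank ℚ V) → ℕ
  norm_pos : ∀ i, 0 < norm i
  map_basis : ∀ i, Q (basis i) = norm i
  basis_mem : ∀ i, basis i ∈ M
  orthogonal : ∀ i j, i ≠ j → QuadraticMap.polar Q (basis i) (basis j) = 0

theorem exists_orthogonalFrame [FiniteDimensional ℚ V] {Q : QuadraticForm ℚ V} (hQ : Q.PosDef)
    {M : Submodule ℤ V} (hM : Submodule.span ℚ (M : Set V) = ⊤) (hint : IsIntegral Q M) :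
    Nonempty (OrthogonalFrame Q M) := by
  obtain ⟨v, hv⟩ := LinearMap.BilinForm.exists_orthogonal_basis (B := QuadraticMap.polarBilin Q)
    ⟨fun x y => by simp [QuadraticMap.polar_comm]⟩
  choose n hn hnM using fun i => exists_int_smul_mem hM (v i)
  let w : Module.Basis (Fin (Module.finrank ℚ V)) ℚ V :=
    v.isUnitSMul (w := fun i => (n i : ℚ)) fun i => (Int.cast_ne_zero.mpr (hn i)).isUnit
  have hw : ∀ i, w i = (n i : ℚ) • v i := fun i => v.isUnitSMul_apply _ i
  have hwM : ∀ i, w i ∈ M := fun i => by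
    rw [hw, Int.cast_smul_eq_zsmul]
    exact hnM i
  choose k hk using fun i => hint _ (hwM i)
  have hkpos : ∀ i, 0 < k i := fun i => by
    have := hQ (w i) (w.ne_zero i)
    rw [hk] at this
    exact_mod_cast this
  refine ⟨⟨w, fun i => (k i).toNat, fun i => by have := hkpos i; omega, fun i => ?_, hwM,
    fun i j hij => ?_⟩⟩
  · rw [hk, ← Int.cast_natCast, Int.toNat_of_nonneg (hkpos i).le]
  · have : QuadraticMap.polar Q (v i) (v j) = 0 := hv hij
    rw [hw, hw, QuadraticMap.polar_smul_left, QuadraticMap.polar_smul_right, this]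
    simp

namespace OrthogonalFrame

variable {Q : QuadraticForm ℚ V} {M : Submodule ℤ V} (e : OrthogonalFrame Q M)

theorem two_mul_norm_ne_zero (i) : (2 * e.norm i : ℚ) ≠ 0 := by
  have := e.norm_pos i
  positivity

theorem polar_sum_smul (c : Fin (Module.finrank ℚ V) → ℚ) (i) :
    QuadraticMap.polar Q (∑ j, c j • e.basis j) (e.basis i) = 2 * e.norm i * c i := by
  rw [← QuadraticMap.polarBilin_apply_apply, map_sum, LinearMap.sum_apply,
    Finset.sum_eq_single i]
  · simp only [map_smul, LinearMap.smul_apply, QuadraticMap.polarBilin_apply_apply,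
      QuadraticMap.polar_self, e.map_basis]
    simp
    ring
  · intro j _ hj
    simp [e.orthogonal j i hj]
  · simp

theorem sum_polar_smul (x : V) :
    ∑ i, (QuadraticMap.polar Q x (e.basis i) / (2 * e.norm i)) • e.basis i = x := by
  conv_rhs => rw [← e.basis.sum_repr x]
  refine Finset.sum_congr rfl fun i _ => ?_
  conv_lhs => rw [← e.basis.sum_repr x]
  rw [e.polar_sum_smul, mul_div_cancel_left₀ _ (e.two_mul_norm_ne_zero i)]

/-- Vectors are determined by their pairings with an orthogonal frame. -/
theorem ext_polar {x y : V}
    (h : ∀ i, QuadraticMap.polar Q x (e.basis i) = QuadraticMap.polar Q y (e.basis i)) : x = y := by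
  rw [← e.sum_polar_smul x, ← e.sum_polar_smul y]
  simp only [h]

theorem polar_eq_sum (x y : V) :
    QuadraticMap.polar Q x y = ∑ i, QuadraticMap.polar Q x (e.basis i) *
      QuadraticMap.polar Q y (e.basis i) / (2 * e.norm i) := by
  conv_lhs => rw [← e.sum_polar_smul y]
  rw [← QuadraticMap.polarBilin_apply_apply, map_sum]
  refine Finset.sum_congr rfl fun i _ => ?_
  rw [map_smul, QuadraticMap.polarBilin_apply_apply, smul_eq_mul]
  ring

theorem map_eq_sum (x : V) :
    Q x = ∑ i, QuadraticMap.polar Q x (e.basis i) ^ 2 / (4 * e.norm i) := by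
  have h := e.polar_eq_sum x x
  rw [QuadraticMap.polar_self, nsmul_eq_mul] at h
  rw [← mul_right_inj' (two_ne_zero (α := ℚ)), ← Nat.cast_ofNat, h, Finset.mul_sum]
  refine Finset.sum_congr rfl fun i _ => ?_
  have := e.two_mul_norm_ne_zero i
  field_simp
  push_cast
  ring

/-- The pairing of a lattice vector with the `i`-th vector of an orthogonal frame, as an integer. -/
noncomputable def coord (hint : IsIntegral Q M) (i : Fin (Module.finrank ℚ V)) : M →+ ℤ where
  toFun x := (hint.exists_polar_eq x.2 (e.basis_mem i)).choose
  map_zero' := Int.cast_injective (α := ℚ) <| by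
    rw [← (hint.exists_polar_eq (0 : M).2 (e.basis_mem i)).choose_spec]
    simp
  map_add' x y := Int.cast_injective (α := ℚ) <| by
    rw [Int.cast_add, ← (hint.exists_polar_eq x.2 (e.basis_mem i)).choose_spec,
      ← (hint.exists_polar_eq y.2 (e.basis_mem i)).choose_spec,
      ← (hint.exists_polar_eq (x + y).2 (e.basis_mem i)).choose_spec, Submodule.coe_add,
      QuadraticMap.polar_add_left]

theorem coe_coord (hint : IsIntegral Q M) (i) (x : M) :
    (e.coord hint i x : ℚ) = QuadraticMap.polar Q x (e.basis i) :=
  (hint.exists_polar_eq x.2 (e.basis_mem i)).choose_spec.symm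

theorem coord_injective (hint : IsIntegral Q M) :
    Function.Injective fun (x : M) i => e.coord hint i x := fun x y h =>
  Subtype.ext (e.ext_polar fun i => by
    rw [← e.coe_coord hint, ← e.coe_coord hint]
    exact_mod_cast congrFun h i)

end OrthogonalFrame

end Frames

/-! ### Even unimodular lattices have rank divisible by eight -/

section RankEight

/-- A finite quadratic Gauss sum `∑ f` over `A` reduces to a subgroup `H` on which `f = 1`, provided
that for `x ∉ H` the function `f` is an eigenfunction on `x + H` of some translation by an element
of `H`, with eigenvalue different from `1`. -/
theorem sum_eq_card_of_translation {A : Type*} [AddCommGroup A] [Fintype A] (H : AddSubgroup A)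
    (f : A → ℂ) (hone : ∀ h ∈ H, f h = 1)
    (htr : ∀ x ∉ H, ∃ h₀ ∈ H, ∃ c : ℂ, c ≠ 1 ∧ ∀ h ∈ H, f (x + (h + h₀)) = c * f (x + h)) :
    ∑ x, f x = Nat.card H := by
  classical
  have := Fintype.ofFinite H
  have hinner : ∀ x, ∑ h : H, f (x + h) = if x ∈ H then (Nat.card H : ℂ) else 0 := fun x => by
    split_ifs with hx
    · rw [Finset.sum_congr rfl fun h _ => hone _ (H.add_mem hx h.2)]
      simp [Nat.card_eq_fintype_card]
    · obtain ⟨h₀, hh₀, c, hc, hf⟩ := htr x hx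
      have h1 : ∑ h : H, f (x + h) = c * ∑ h : H, f (x + h) := by
        rw [Finset.mul_sum, ← Equiv.sum_comp (Equiv.addRight (⟨h₀, hh₀⟩ : H))]
        exact Finset.sum_congr rfl fun h _ => hf h h.2
      have h2 : (1 - c) * ∑ h : H, f (x + h) = 0 := by linear_combination h1
      exact (mul_eq_zero.mp h2).resolve_left (sub_ne_zero.mpr hc.symm)
  have h1 : ∑ x, ∑ h : H, f (x + h) = Nat.card H * Nat.card H := by
    rw [Finset.sum_congr rfl fun x _ => hinner x, ← Finset.sum_filter, Finset.sum_const,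
      nsmul_eq_mul]
    congr 2
    rw [Nat.card_eq_fintype_card, Fintype.card_subtype]
  have h2 : ∑ x, ∑ h : H, f (x + h) = Nat.card H * ∑ x, f x := by
    have htrans : ∀ h : H, ∑ x, f (x + h) = ∑ x, f x := fun h =>
      Equiv.sum_comp (Equiv.addRight (h : A)) f
    rw [Finset.sum_comm]
    simp only [htrans]
    simp [Nat.card_eq_fintype_card]
  exact mul_left_cancel₀ (Nat.cast_ne_zero.mpr Nat.card_pos.ne') (h2.symm.trans h1)

/-- The summand `exp (π i x² / (2a))` of the quadratic Gauss sum, as a function on `ℤ / 2a`. -/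
noncomputable def gaussTerm (a : ℕ) (x : ZMod (2 * a)) : ℂ :=
  Complex.exp (Real.pi * Complex.I * x.val ^ 2 / (2 * a))

theorem gaussTerm_intCast {a : ℕ} (ha : 0 < a) (k : ℤ) :
    gaussTerm a k = Complex.exp (Real.pi * Complex.I * k ^ 2 / (2 * a)) := by
  have : NeZero (2 * a) := ⟨by omega⟩
  have ha' : (a : ℂ) ≠ 0 := by exact_mod_cast ha.ne'
  have h : (k : ℂ) = ((k : ZMod (2 * a)).val : ℂ) + 2 * a * (k / (2 * a : ℕ) : ℤ) := by
    have h1 := ZMod.val_intCast (n := 2 * a) k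
    have h2 := Int.emod_add_mul_ediv k (2 * a : ℕ)
    rw [← h1] at h2
    conv_lhs => rw [← h2]
    push_cast
    rfl
  generalize (k / (2 * a : ℕ) : ℤ) = q at h
  rw [gaussTerm, h, eq_comm, Complex.exp_eq_exp_iff_exists_int]
  refine ⟨(k : ZMod (2 * a)).val * q + a * q ^ 2, ?_⟩
  push_cast
  field_simp
  ring

theorem _root_.ZMod.sum_val {R : Type*} [AddCommMonoid R] (n : ℕ) [NeZero n] (F : ℕ → R) :
    ∑ x : ZMod n, F x.val = ∑ r : Fin n, F r := by
  obtain ⟨m, rfl⟩ := Nat.exists_eq_succ_of_ne_zero (NeZero.ne n)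
  rfl

theorem sum_gaussTerm {a : ℕ} (ha : 0 < a) [NeZero (2 * a)] :
    ∑ x, gaussTerm a x = Real.sqrt (2 * a) * Complex.exp (Real.pi * Complex.I / 4) := by
  rw [← sum_exp_sq_div_two_mul ha]
  exact ZMod.sum_val (2 * a) fun k => Complex.exp (Real.pi * Complex.I * k ^ 2 / (2 * a))

theorem exp_two_pi_mul_rat_eq_one_iff (q : ℚ) :
    Complex.exp (2 * Real.pi * Complex.I * q) = 1 ↔ ∃ k : ℤ, q = k := by
  rw [Complex.exp_eq_one_iff]
  refine exists_congr fun k => ⟨fun h => ?_, fun h => by rw [h]; push_cast; ring⟩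
  rw [mul_comm] at h
  have := mul_right_cancel₀ Complex.two_pi_I_ne_zero h
  exact_mod_cast this

/-- The product of the one-dimensional Gauss summands along an orthogonal frame is the character
`exp (2 π i Q(y))`, at the vector `y` whose pairings with the frame are the integers `X i`. -/
theorem OrthogonalFrame.prod_gaussTerm {V : Type*} [AddCommGroup V] [Module ℚ V]
    {Q : QuadraticForm ℚ V} {M : Submodule ℤ V} (e : OrthogonalFrame Q M)
    (X : Fin (Module.finrank ℚ V) → ℤ) (y : V)
    (h : ∀ i, QuadraticMap.polar Q y (e.basis i) = X i) :
    ∏ i, gaussTerm (e.norm i) (X i) = Complex.exp (2 * Real.pi * Complex.I * (Q y : ℚ)) := by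
  rw [e.map_eq_sum y, Finset.prod_congr rfl fun i _ => gaussTerm_intCast (e.norm_pos i) (X i),
    ← Complex.exp_sum, Rat.cast_sum, Finset.mul_sum]
  congr 1
  refine Finset.sum_congr rfl fun i _ => ?_
  rw [h]
  push_cast
  have : (e.norm i : ℂ) ≠ 0 := by exact_mod_cast (e.norm_pos i).ne'
  field_simp
  ring

/-- The rank of a positive definite even unimodular lattice is divisible by eight. With respect to
an orthogonal frame in `M`, the Gauss sum of the discriminant group of the frame is the index of
the frame in `M`, because `M` is its own orthogonal complement there; on the other hand it is a
product of one-dimensional Gauss sums, each a positive multiple of `exp (π i / 4)`. -/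
theorem eight_dvd_finrank {V : Type*} [AddCommGroup V] [Module ℚ V] [FiniteDimensional ℚ V]
    {Q : QuadraticForm ℚ V} (hQ : Q.PosDef) {M : Submodule ℤ V}
    (hM : Submodule.span ℚ (M : Set V) = ⊤) (hint : IsIntegral Q M)
    (hdual : ∀ x, (∀ y ∈ M, ∃ k : ℤ, QuadraticMap.polar Q x y = k) → x ∈ M) :
    8 ∣ Module.finrank ℚ V := by
  obtain ⟨e⟩ := exists_orthogonalFrame hQ hM hint
  have : ∀ i, NeZero (2 * e.norm i) := fun i => ⟨by have := e.norm_pos i; omega⟩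
  let φ : M →+ ∀ i, ZMod (2 * e.norm i) :=
    AddMonoidHom.pi fun i => (Int.castAddHom (ZMod (2 * e.norm i))).comp (e.coord hint i)
  have hφ : ∀ v i, φ v i = (e.coord hint i v : ℤ) := fun _ _ => rfl
  let f : (∀ i, ZMod (2 * e.norm i)) → ℂ := fun x => ∏ i, gaussTerm (e.norm i) (x i)
  have hsum : ∑ x, f x = Nat.card φ.range := by
    refine sum_eq_card_of_translation φ.range f ?_ fun x hx => ?_
    · rintro _ ⟨v, rfl⟩
      obtain ⟨k, hk⟩ := hint _ v.2
      exact (e.prod_gaussTerm _ v fun i => (e.coe_coord hint i v).symm).trans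
        ((exp_two_pi_mul_rat_eq_one_iff _).mpr ⟨k, hk⟩)
    · choose X hX using fun i => ZMod.intCast_surjective (x i)
      -- `w` represents `x` in the dual lattice of the frame
      obtain ⟨w, hw⟩ : ∃ w : V, ∀ i, QuadraticMap.polar Q w (e.basis i) = X i :=
        ⟨∑ i, ((X i : ℚ) / (2 * e.norm i)) • e.basis i, fun i => by
          rw [e.polar_sum_smul, mul_div_cancel₀ _ (e.two_mul_norm_ne_zero i)]⟩
      have hwM : w ∉ M := fun h => hx ⟨⟨w, h⟩, funext fun i => by
        rw [hφ, ← hX]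
        congr 1
        exact_mod_cast (e.coe_coord hint i ⟨w, h⟩).trans (hw i)⟩
      obtain ⟨v₀, hv₀, hv₀'⟩ : ∃ v₀ ∈ M, ¬ ∃ k : ℤ, QuadraticMap.polar Q w v₀ = k := by
        by_contra! h
        exact hwM (hdual w h)
      have hf : ∀ v : M, f (x + φ v) = Complex.exp (2 * Real.pi * Complex.I * (Q (w + v) : ℚ)) := by
        intro v
        rw [← e.prod_gaussTerm (fun i => X i + e.coord hint i v) (w + v) fun i => by
          rw [QuadraticMap.polar_add_left, hw, ← e.coe_coord hint i v, Int.cast_add]]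
        refine Finset.prod_congr rfl fun i _ => ?_
        rw [Pi.add_apply, hφ, ← hX, Int.cast_add]
      refine ⟨φ ⟨v₀, hv₀⟩, ⟨_, rfl⟩, _, mt (exp_two_pi_mul_rat_eq_one_iff _).mp hv₀', ?_⟩
      rintro _ ⟨v, rfl⟩
      rw [← map_add, hf, hf]
      obtain ⟨k, hk⟩ := hint _ hv₀
      obtain ⟨l, hl⟩ := hint.exists_polar_eq v.2 hv₀
      have hQ' : Q (w + (v + ⟨v₀, hv₀⟩ : M)) =
          QuadraticMap.polar Q w v₀ + Q (w + v) + (k + l : ℤ) := by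
        rw [Submodule.coe_add, ← add_assoc, QuadraticMap.map_add Q, QuadraticMap.polar_add_left, hk,
          hl]
        push_cast
        ring
      rw [hQ', Rat.cast_add, mul_add, Complex.exp_add,
        (exp_two_pi_mul_rat_eq_one_iff ((k + l : ℤ) : ℚ)).mpr ⟨_, rfl⟩, mul_one, Rat.cast_add,
        mul_add, Complex.exp_add]
  set d := Module.finrank ℚ V
  set ζ := Complex.exp (Real.pi * Complex.I / 4) with hζ
  have hζn : ‖ζ‖ = 1 := by
    rw [hζ, show (Real.pi * Complex.I / 4 : ℂ) = ((Real.pi / 4 : ℝ) : ℂ) * Complex.I by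
      push_cast; ring, Complex.norm_exp_ofReal_mul_I]
  have hprod : ∑ x, f x = ((∏ i, Real.sqrt (2 * e.norm i) : ℝ) : ℂ) * ζ ^ d := by
    rw [← Fintype.prod_sum, Finset.prod_congr rfl fun i _ => sum_gaussTerm (e.norm_pos i),
      Finset.prod_mul_distrib, Finset.prod_const, Finset.card_univ, Fintype.card_fin,
      Complex.ofReal_prod]
  have hpos : 0 < ∏ i, Real.sqrt (2 * e.norm i) := Finset.prod_pos fun i _ => by
    have := e.norm_pos i
    positivity
  have heq := hprod.symm.trans hsum
  have hnorm := congrArg norm heq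
  rw [norm_mul, norm_pow, hζn, one_pow, mul_one, Complex.norm_real, Real.norm_of_nonneg hpos.le,
    Complex.norm_natCast] at hnorm
  rw [hnorm, Complex.ofReal_natCast, mul_eq_left₀ (by
    rw [← Complex.ofReal_natCast, ← hnorm]
    exact_mod_cast hpos.ne'), hζ, ← Complex.exp_nat_mul, Complex.exp_eq_one_iff] at heq
  obtain ⟨k, hk⟩ := heq
  have h8 : (d : ℂ) = 8 * k := by
    have hπ : (Real.pi : ℂ) ≠ 0 := by exact_mod_cast Real.pi_ne_zero
    refine mul_right_cancel₀ (mul_ne_zero hπ Complex.I_ne_zero) ?_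
    linear_combination 4 * hk
  have h8' : (d : ℤ) = 8 * k := by exact_mod_cast h8
  omega

end RankEight

/-! ### Convergence of theta series -/

section Convergence

theorem summable_exp_neg_mul_int_sq {c : ℝ} (hc : 0 < c) :
    Summable fun n : ℤ => Real.exp (-c * n ^ 2) := by
  have := summable_pow_mul_jacobiTheta₂_term_bound 0 (div_pos hc Real.pi_pos) 0
  refine this.congr fun n => ?_
  rw [pow_zero, one_mul]
  congr 1
  field_simp
  ring

theorem summable_fin_prod {f : ℤ → ℝ} (hf : Summable f) (h0 : 0 ≤ f) (n : ℕ) :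
    Summable fun k : Fin n → ℤ => ∏ i, f (k i) := by
  induction n with
  | zero => exact (hasSum_fintype _).summable
  | succ n ih =>
    rw [← (Fin.consEquiv fun _ => ℤ).summable_iff]
    refine (hf.mul_of_nonneg ih h0 fun k => Finset.prod_nonneg fun i _ => h0 _).congr fun k => ?_
    simp [Fin.prod_univ_succ, Fin.consEquiv]

theorem summable_exp_neg_mul_sum_sq {ι : Type*} [Fintype ι] {c : ℝ} (hc : 0 < c) :
    Summable fun k : ι → ℤ => Real.exp (-c * ∑ i, (k i : ℝ) ^ 2) := by
  have h := summable_fin_prod (summable_exp_neg_mul_int_sq hc) (fun n => (Real.exp_pos _).le)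
    (Fintype.card ι)
  rw [← (Equiv.arrowCongr (Fintype.equivFin ι) (Equiv.refl ℤ)).summable_iff] at h
  refine h.congr fun k => ?_
  rw [Finset.mul_sum, Real.exp_sum, ← (Fintype.equivFin ι).symm.prod_comp]
  rfl

open Matrix in
theorem _root_.Matrix.PosDef.exists_mul_sum_sq_le {n : ℕ} {Y : Matrix (Fin n) (Fin n) ℝ}
    (hY : Y.PosDef) : ∃ ε > 0, ∀ v : Fin n → ℝ, ε * ∑ i, v i ^ 2 ≤ v ⬝ᵥ Y *ᵥ v := by
  have hpos : ∀ v : Fin n → ℝ, v ≠ 0 → 0 < v ⬝ᵥ Y *ᵥ v := fun v hv => by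
    simpa using hY.dotProduct_mulVec_pos hv
  have hcont : Continuous fun v : Fin n → ℝ => v ⬝ᵥ Y *ᵥ v := by fun_prop
  obtain ⟨δ, hδ, h⟩ : ∃ δ > 0, ∀ v ∈ Metric.sphere (0 : Fin n → ℝ) 1, δ ≤ v ⬝ᵥ Y *ᵥ v := by
    rcases (Metric.sphere (0 : Fin n → ℝ) 1).eq_empty_or_nonempty with he | hne
    · exact ⟨1, one_pos, fun v hv => by simp [he] at hv⟩
    · obtain ⟨v, hv, hmin⟩ := (isCompact_sphere (0 : Fin n → ℝ) 1).exists_isMinOn hne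
        hcont.continuousOn
      exact ⟨_, hpos v (ne_zero_of_mem_unit_sphere ⟨v, hv⟩), fun w hw => hmin hw⟩
  refine ⟨δ / (n + 1), by positivity, fun v => ?_⟩
  rcases eq_or_ne v 0 with rfl | hv
  · simp
  have hn : ‖v‖ ≠ 0 := norm_ne_zero_iff.mpr hv
  have hs : ∑ i, v i ^ 2 ≤ (n + 1) * ‖v‖ ^ 2 := by
    calc ∑ i, v i ^ 2 ≤ ∑ _i : Fin n, ‖v‖ ^ 2 := Finset.sum_le_sum fun i _ => by
          rw [← sq_abs]
          exact pow_le_pow_left₀ (abs_nonneg _) (norm_le_pi_norm v i) 2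
      _ ≤ (n + 1) * ‖v‖ ^ 2 := by
          rw [Finset.sum_const, Finset.card_univ, Fintype.card_fin, nsmul_eq_mul]
          nlinarith [sq_nonneg ‖v‖]
  have hu := h (‖v‖⁻¹ • v) (by simp [norm_smul, hn])
  rw [mulVec_smul, smul_dotProduct, dotProduct_smul, smul_eq_mul, smul_eq_mul] at hu
  calc δ / (n + 1) * ∑ i, v i ^ 2 ≤ δ / (n + 1) * ((n + 1) * ‖v‖ ^ 2) := by gcongr
    _ = δ * ‖v‖ ^ 2 := by field_simp
    _ ≤ ‖v‖⁻¹ * (‖v‖⁻¹ * v ⬝ᵥ Y *ᵥ v) * ‖v‖ ^ 2 := by gcongr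
    _ = v ⬝ᵥ Y *ᵥ v := by field_simp

theorem norm_expTrace {n : ℕ} (T : Matrix (Fin n) (Fin n) ℚ) (Z : Matrix (Fin n) (Fin n) ℂ) :
    ‖expTrace T Z‖ = Real.exp (-(2 * Real.pi * ∑ i, ∑ j, (T i j : ℝ) * (Z j i).im)) := by
  have him : (T.map (fun q : ℚ => (q : ℂ)) * Z).trace.im = ∑ i, ∑ j, (T i j : ℝ) * (Z j i).im := by
    simp only [Matrix.trace, Matrix.diag, Matrix.mul_apply, Matrix.map_apply, Complex.im_sum]
    refine Finset.sum_congr rfl fun i _ => Finset.sum_congr rfl fun j _ => ?_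
    rw [← Complex.ofReal_ratCast, Complex.im_ofReal_mul]
  rw [expTrace, Complex.norm_exp, ← him]
  congr 1
  simp

variable {V : Type*} [AddCommGroup V] [Module ℚ V] {Q : QuadraticForm ℚ V} {M : Submodule ℤ V}

open Matrix in
/-- In the integral coordinates of an orthogonal frame, `tr(Q(x) Y)` is a weighted sum of values of
the quadratic form `Y`. -/
theorem OrthogonalFrame.sum_halfGram_mul (e : OrthogonalFrame Q M) (hint : IsIntegral Q M) {n : ℕ}
    (x : Fin n → M) (Y : Matrix (Fin n) (Fin n) ℝ) :
    ∑ i, ∑ j, (halfGram Q (fun i => (x i : V)) i j : ℝ) * Y j i =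
      ∑ l, (1 / (4 * e.norm l) : ℝ) *
        ((fun i => (e.coord hint l (x i) : ℝ)) ⬝ᵥ Y *ᵥ fun i => (e.coord hint l (x i) : ℝ)) := by
  have h : ∀ i j, (halfGram Q (fun i => (x i : V)) i j : ℝ) =
      ∑ l, (1 / (4 * e.norm l) : ℝ) * (e.coord hint l (x i) * e.coord hint l (x j)) := by
    intro i j
    have hq : halfGram Q (fun i => (x i : V)) i j =
        ∑ l, (1 / (4 * e.norm l) : ℚ) * (e.coord hint l (x i) * e.coord hint l (x j)) := by
      rw [halfGram, Matrix.of_apply, e.polar_eq_sum, Finset.sum_div]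
      refine Finset.sum_congr rfl fun l _ => ?_
      rw [e.coe_coord, e.coe_coord]
      have := e.two_mul_norm_ne_zero l
      field_simp
      ring
    rw [hq]
    push_cast
    rfl
  simp only [h, dotProduct, mulVec, Finset.mul_sum, Finset.sum_mul]
  rw [Finset.sum_comm, Finset.sum_comm (s := (Finset.univ : Finset (Fin (Module.finrank ℚ V))))]
  refine Finset.sum_congr rfl fun j _ => ?_
  rw [Finset.sum_comm]
  exact Finset.sum_congr rfl fun l _ => Finset.sum_congr rfl fun i _ => by ring

/-- Absolute convergence of the theta series of a positive definite integral lattice: in the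
integral coordinates of an orthogonal frame it is dominated by a Gaussian sum over `ℤ^N`. -/
theorem summable_norm_expTrace_halfGram [FiniteDimensional ℚ V] (hQ : Q.PosDef)
    (hM : Submodule.span ℚ (M : Set V) = ⊤) (hint : IsIntegral Q M) {n : ℕ}
    {Z : Matrix (Fin n) (Fin n) ℂ} (hZ : Z ∈ siegelUpperHalfSpace n) :
    Summable fun x : Fin n → M => ‖expTrace (halfGram Q fun i => (x i : V)) Z‖ := by
  obtain ⟨e⟩ := exists_orthogonalFrame hQ hM hint
  obtain ⟨ε, hε, hY⟩ := hZ.2.exists_mul_sum_sq_le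
  -- `A + 1` is a positive bound for all the norms, also when the frame is empty
  set A : ℝ := ∑ l, (e.norm l : ℝ)
  have hA0 : ∀ l, (e.norm l : ℝ) ≤ A + 1 := fun l =>
    (Finset.single_le_sum (fun l _ => Nat.cast_nonneg (e.norm l)) (Finset.mem_univ l)).trans
      (le_add_of_nonneg_right zero_le_one)
  have hA1 : 0 < A + 1 := by positivity
  set c : ℝ := 2 * Real.pi * (1 / (4 * (A + 1)) * ε) with hc
  have hinj : Function.Injective fun (x : Fin n → M) (q : Fin n × Fin (Module.finrank ℚ V)) =>
      e.coord hint q.2 (x q.1) := fun x y h =>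
    funext fun i => e.coord_injective hint (funext fun l => congrFun h (i, l))
  refine Summable.of_nonneg_of_le (fun _ => norm_nonneg _) (fun x => ?_)
    ((summable_exp_neg_mul_sum_sq (c := c) (by positivity)).comp_injective hinj)
  rw [norm_expTrace, Function.comp_apply, Real.exp_le_exp, neg_mul, neg_le_neg_iff, hc, mul_assoc]
  refine mul_le_mul_of_nonneg_left ?_ (by positivity)
  have h := e.sum_halfGram_mul hint x (Z.map Complex.im)
  simp only [Matrix.map_apply] at h
  rw [h, Fintype.sum_prod_type_right, Finset.mul_sum]
  refine Finset.sum_le_sum fun l _ => ?_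
  rw [mul_assoc]
  have hl : (0 : ℝ) < e.norm l := by exact_mod_cast e.norm_pos l
  have hA2 := hA0 l
  refine mul_le_mul ?_ (hY _) (by positivity) (by positivity)
  gcongr

theorem I_smul_one_mem_siegelUpperHalfSpace (n : ℕ) :
    (Complex.I • (1 : Matrix (Fin n) (Fin n) ℂ)) ∈ siegelUpperHalfSpace n := by
  refine ⟨by simp [Matrix.IsSymm], ?_⟩
  have : (Complex.I • (1 : Matrix (Fin n) (Fin n) ℂ)).map Complex.im = 1 := by
    ext i j
    by_cases h : i = j <;> simp [Matrix.one_apply, h]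
  rw [this]
  exact Matrix.PosDef.one

theorem finite_representations [FiniteDimensional ℚ V] (hQ : Q.PosDef)
    (hM : Submodule.span ℚ (M : Set V) = ⊤) (hint : IsIntegral Q M) {n : ℕ}
    (T : HalfIntegralMatrix n) : (representations Q M T).Finite := by
  -- at `Z = i` the terms of the convergent theta series over the representations of `T` are equal
  set Z := Complex.I • (1 : Matrix (Fin n) (Fin n) ℂ)
  have hs := (summable_norm_expTrace_halfGram hQ hM hint
    (I_smul_one_mem_siegelUpperHalfSpace n)).tendsto_cofinite_zero
  have hpos : 0 < ‖expTrace T.1 Z‖ := by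
    rw [norm_expTrace]
    positivity
  have hev := hs.eventually (gt_mem_nhds hpos)
  rw [Filter.eventually_cofinite] at hev
  refine hev.subset fun x hx => ?_
  rw [Set.mem_ofPred_eq, show halfGram Q (fun i => (x i : V)) = T.1 from hx]
  exact lt_irrefl _

/-- The half-integral matrix `Q(x)` of a tuple of vectors of an integral lattice. -/
def halfIntegralGram (hint : IsIntegral Q M) {n : ℕ} (x : Fin n → M) : HalfIntegralMatrix n :=
  ⟨halfGram Q fun i => (x i : V), by
    refine ⟨?_, fun i => ?_, fun i j => ?_⟩
    · ext i j
      simp [halfGram, QuadraticMap.polar_comm]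
    · obtain ⟨k, hk⟩ := hint _ (x i).2
      exact ⟨k, by simp [halfGram, QuadraticMap.polar_self, hk]⟩
    · obtain ⟨k, hk⟩ := hint.exists_polar_eq (x i).2 (x j).2
      exact ⟨k, by simp only [halfGram, Matrix.of_apply, hk]; ring⟩⟩

/-- Grouping the theta series according to the value of `Q(x)` gives its Fourier expansion. -/
theorem hasFourierExpansion_thetaSeries [FiniteDimensional ℚ V] (hQ : Q.PosDef)
    (hM : Submodule.span ℚ (M : Set V) = ⊤) (hint : IsIntegral Q M) (n : ℕ) :
    HasFourierExpansion (thetaSeries Q M n) (thetaCoeff Q M) := by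
  intro Z hZ
  have hs := (summable_norm_expTrace_halfGram hQ hM hint hZ).of_norm.hasSum.tsum_fiberwise
    (halfIntegralGram hint)
  refine Eq.mp (congrArg (HasSum · _) (funext fun T => ?_)) hs
  have hset : halfIntegralGram hint ⁻¹' {T} = representations Q M T := by
    ext x
    exact Subtype.ext_iff
  have hterm : ∀ x : halfIntegralGram hint ⁻¹' {T},
      expTrace (halfGram Q fun i => ((x : Fin n → M) i : V)) Z = expTrace T.1 Z := fun x => by
    have h := congrArg Subtype.val (show halfIntegralGram hint x = T from x.2)
    exact congrArg (expTrace · Z) h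
  rw [tsum_congr hterm, tsum_const, hset, thetaCoeff, Nat.card_coe_set_eq, nsmul_eq_mul]
  push_cast
  rfl

end Convergence

/-! ### The fixed lattice of an isometry of prime order -/

section FixedLattice

variable {V : Type*} [AddCommGroup V] [Module ℚ V] {Q : QuadraticForm ℚ V} {M : Submodule ℤ V}
  {σ : V ≃ₗ[ℚ] V}

theorem mem_fixedSpace {v : V} : v ∈ fixedSpace σ ↔ σ v = v :=
  LinearMap.mem_fixedSubmodule_iff

theorem polar_isometry (hσ : σ ∈ latticeIsometryGroup Q M) (x y : V) :
    QuadraticMap.polar Q (σ x) (σ y) = QuadraticMap.polar Q x y := by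
  simp only [QuadraticMap.polar, ← map_add, hσ.1]

/-- An isometry of order `p` acts on the set of representations of `T`, so that without fixed
representations their number is divisible by `p`. -/
theorem prime_dvd_ncard_representations {p : ℕ} (hp : p.Prime) (hσ : σ ∈ latticeIsometryGroup Q M)
    (hord : orderOf σ = p) {n : ℕ} (T : HalfIntegralMatrix n) (hfin : (representations Q M T).Finite)
    (hfix : ∀ x ∈ representations Q M T, ∃ i, (x i : V) ∉ fixedSpace σ) :
    p ∣ (representations Q M T).ncard := by
  classical
  have : Fact p.Prime := ⟨hp⟩
  have := hfin.fintype
  let F : Function.End (representations Q M T) := fun x =>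
    ⟨fun i => ⟨σ (x.1 i), (hσ.2 _).mpr (x.1 i).2⟩, by
      have hx : halfGram Q (fun i => (x.1 i : V)) = T.1 := x.2
      change halfGram Q (fun i => σ (x.1 i)) = T.1
      rw [← hx]
      simp only [halfGram, polar_isometry hσ]⟩
  have hpow : ∀ (k : ℕ) (x : representations Q M T) (i : Fin n),
      ((((F ^ k : Function.End _) x).1 i : M) : V) = (σ ^ k) (x.1 i) := by
    intro k
    induction k with
    | zero => exact fun _ _ => rfl
    | succ k ih =>
      intro x i
      rw [pow_succ, pow_succ]
      exact ih (F x) i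
  have hF : F ^ p ^ 1 = 1 := by
    funext x
    refine Subtype.ext (funext fun i => Subtype.ext ?_)
    rw [pow_one, hpow, ← hord, pow_orderOf_eq_one]
    rfl
  have hcard := Equiv.Perm.card_fixedPoints_modEq hF
  have hempty : IsEmpty (Function.fixedPoints F) := ⟨fun x => by
    obtain ⟨i, hi⟩ := hfix x.1.1 x.1.2
    refine hi (mem_fixedSpace.mpr ?_)
    have h := congrArg (fun y : representations Q M T => ((y.1 i : M) : V)) x.2
    exact h⟩
  rw [Fintype.card_eq_zero (α := Function.fixedPoints F)] at hcard
  rw [← Nat.card_coe_set_eq, Nat.card_eq_fintype_card]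
  exact (Nat.modEq_zero_iff_dvd).mp hcard

/-- The trace `∑ σ^i x` of a vector under an isometry of order `p` is fixed, and pairs with fixed
vectors as `p • x` does. -/
theorem exists_trace (hσ : σ ∈ latticeIsometryGroup Q M) {p : ℕ} (hord : orderOf σ = p) {m : V}
    (hm : m ∈ M) : ∃ s ∈ M, s ∈ fixedSpace σ ∧
      ∀ v ∈ fixedSpace σ, QuadraticMap.polar Q s v = p * QuadraticMap.polar Q m v := by
  have hpowM : ∀ k : ℕ, (σ ^ k) m ∈ M := fun k => ((pow_mem hσ k).2 m).mpr hm
  refine ⟨∑ k ∈ Finset.range p, (σ ^ k) m, M.sum_mem fun k _ => hpowM k, ?_, fun v hv => ?_⟩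
  · rw [mem_fixedSpace, map_sum]
    have h : ∀ k, σ ((σ ^ k) m) = (σ ^ (k + 1)) m := fun k => by rw [pow_succ']; rfl
    rw [Finset.sum_congr rfl fun k _ => h k]
    have h1 := Finset.sum_range_succ (fun k => (σ ^ k) m) p
    have h2 := Finset.sum_range_succ' (fun k => (σ ^ k) m) p
    rw [h1, ← hord, pow_orderOf_eq_one, hord, pow_zero] at h2
    exact (add_right_cancel h2).symm
  · have hv' : ∀ k : ℕ, (σ ^ k) v = v := fun k => by
      induction k with
      | zero => rfl
      | succ k ih =>
        rw [pow_succ, LinearEquiv.mul_apply, mem_fixedSpace.mp hv, ih]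
    have hk : ∀ k : ℕ, QuadraticMap.polar Q ((σ ^ k) m) v = QuadraticMap.polar Q m v := fun k => by
      conv_lhs => rw [← hv' k]
      exact polar_isometry (pow_mem hσ k) m v
    rw [← QuadraticMap.polarBilin_apply_apply, map_sum, LinearMap.sum_apply]
    simp [hk]

/-- Every vector of `M` has the same pairings with the fixed space as some vector of the fixed
lattice; that is, the orthogonal projection to the fixed space maps `M` to itself. -/
def ProjectsToFixedLattice (Q : QuadraticForm ℚ V) (M : Submodule ℤ V) (σ : V ≃ₗ[ℚ] V) : Prop :=
  ∀ m ∈ M, ∃ m' ∈ M, m' ∈ fixedSpace σ ∧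
    ∀ v ∈ fixedSpace σ, QuadraticMap.polar Q m v = QuadraticMap.polar Q m' v

theorem HalfIntegralMatrix.exists_det_eq {n : ℕ} (T : HalfIntegralMatrix n) :
    ∃ G : Matrix (Fin n) (Fin n) ℤ, (∀ i j, (G i j : ℚ) = 2 * T.1 i j) ∧
      (G.det : ℚ) = 2 ^ n * T.1.det := by
  choose G hG using T.2.2.2
  refine ⟨Matrix.of G, fun i j => (hG i j).symm, ?_⟩
  have h : (Matrix.of G).map (Int.castRingHom ℚ) = (2 : ℚ) • T.1 := by
    ext i j
    simp [hG]
  have h' := (Int.castRingHom ℚ).map_det (Matrix.of G)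
  rw [RingHom.mapMatrix_apply, h, Matrix.det_smul, Fintype.card_fin] at h'
  exact h'

/-- If some `x` in the fixed lattice has a Gram matrix `G` of maximal size with `p ∤ det G`, then
the projection to the fixed space preserves `M`: the projection of a vector of `M` becomes a vector
of `M` after multiplication by `p`, by means of the trace, and after multiplication by `det G`, by
Cramer's rule. -/
theorem projectsToFixedLattice_of_not_dvd_det [FiniteDimensional ℚ V] (hQ : Q.PosDef)
    (hint : IsIntegral Q M) {p : ℕ} (hp : p.Prime) (hσ : σ ∈ latticeIsometryGroup Q M)
    (hord : orderOf σ = p) {n : ℕ} (hn : Module.finrank ℚ (fixedSpace σ) = n)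
    {x : Fin n → V} (hxM : ∀ i, x i ∈ M) (hx : ∀ i, x i ∈ fixedSpace σ)
    {G : Matrix (Fin n) (Fin n) ℤ} (hG : ∀ i j, (G i j : ℚ) = QuadraticMap.polar Q (x i) (x j))
    (hdvd : ¬ (p : ℤ) ∣ G.det) : ProjectsToFixedLattice Q M σ := by
  have hdet : G.det ≠ 0 := fun h => hdvd (h ▸ dvd_zero _)
  have hpolar_sum : ∀ (c : Fin n → ℚ) i, QuadraticMap.polar Q (∑ j, c j • x j) (x i) =
      ∑ j, c j * QuadraticMap.polar Q (x j) (x i) := fun c i => by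
    rw [← QuadraticMap.polarBilin_apply_apply, map_sum, LinearMap.sum_apply]
    simp
  have hsymm : ∀ i j, G i j = G j i := fun i j => by
    have : (G i j : ℚ) = G j i := by rw [hG, hG, QuadraticMap.polar_comm]
    exact_mod_cast this
  have hli : LinearIndependent ℚ x := by
    rw [Fintype.linearIndependent_iff]
    intro c hc
    have hGc : (G.map (Int.castRingHom ℚ)).mulVec c = 0 := by
      funext i
      have := hpolar_sum c i
      rw [hc, QuadraticMap.polar_zero_left] at this
      rw [Pi.zero_apply, this, Matrix.mulVec, dotProduct]
      refine Finset.sum_congr rfl fun j _ => ?_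
      rw [Matrix.map_apply, hsymm, eq_intCast, hG, mul_comm]
    refine congrFun (Matrix.eq_zero_of_mulVec_eq_zero ?_ hGc)
    rw [← RingHom.mapMatrix_apply, ← RingHom.map_det, eq_intCast]
    exact_mod_cast hdet
  have hspan : Submodule.span ℚ (Set.range x) = fixedSpace σ := by
    refine Submodule.eq_of_le_of_finrank_eq (Submodule.span_le.mpr ?_) ?_
    · rintro _ ⟨i, rfl⟩
      exact hx i
    · rw [finrank_span_eq_card hli, hn, Fintype.card_fin]
  have hzero : ∀ v ∈ fixedSpace σ, (∀ i, QuadraticMap.polar Q v (x i) = 0) → v = 0 := by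
    intro v hv h
    have hle : fixedSpace σ ≤ LinearMap.ker (QuadraticMap.polarBilin Q v) := by
      rw [← hspan, Submodule.span_le]
      rintro _ ⟨i, rfl⟩
      exact h i
    have hvv : QuadraticMap.polar Q v v = 0 := hle hv
    rw [QuadraticMap.polar_self, nsmul_eq_mul] at hvv
    by_contra hne
    have := hQ v hne
    norm_num at hvv
    exact this.ne' hvv
  intro m hm
  obtain ⟨s, hsM, hsV, hs⟩ := exists_trace hσ hord hm
  choose z hz using fun i => hint.exists_polar_eq hm (hxM i)
  -- Cramer's rule: `y` is the combination of the `x i` with coefficients `adj(G) z`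
  set y : V := ∑ j, (G.adjugate.mulVec z j) • x j with hy
  have hyM : y ∈ M := M.sum_mem fun j _ => M.smul_mem _ (hxM j)
  have hyV : y ∈ fixedSpace σ := by
    refine Submodule.sum_mem _ fun j _ => ?_
    rw [← Int.cast_smul_eq_zsmul ℚ]
    exact Submodule.smul_mem _ _ (hx j)
  have hyx : ∀ i, QuadraticMap.polar Q y (x i) = G.det * z i := by
    intro i
    have h1 : G.mulVec (G.adjugate.mulVec z) i = G.det * z i := by
      rw [Matrix.mulVec_mulVec, Matrix.mul_adjugate, Matrix.smul_mulVec, Matrix.one_mulVec]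
      rfl
    have h2 := hpolar_sum (fun j => (G.adjugate.mulVec z j : ℚ)) i
    simp only [Int.cast_smul_eq_zsmul] at h2
    rw [hy, h2]
    rw [← Int.cast_mul, ← h1, Matrix.mulVec, dotProduct, Int.cast_sum]
    refine Finset.sum_congr rfl fun j _ => ?_
    rw [hsymm, Int.cast_mul, hG, mul_comm]
  have hsy : (G.det : ℚ) • s = (p : ℚ) • y := by
    refine sub_eq_zero.mp (hzero _ (Submodule.sub_mem _ (Submodule.smul_mem _ _ hsV)
      (Submodule.smul_mem _ _ hyV)) fun i => ?_)
    rw [QuadraticMap.polar_sub_left, QuadraticMap.polar_smul_left, QuadraticMap.polar_smul_left,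
      hs _ (hx i), hyx, hz]
    simp only [smul_eq_mul]
    ring
  obtain ⟨a, b, hab⟩ : IsCoprime (p : ℤ) G.det :=
    (Nat.prime_iff_prime_int.mp hp).irreducible.coprime_iff_not_dvd.mpr hdvd
  have hps : s = (p : ℚ) • (a • s + b • y) := by
    have hab' : (a * p + b * G.det : ℚ) = 1 := by exact_mod_cast hab
    rw [← Int.cast_smul_eq_zsmul ℚ a, ← Int.cast_smul_eq_zsmul ℚ b, smul_add, smul_comm _ (b : ℚ),
      ← hsy, smul_smul, smul_smul, ← add_smul, mul_comm (p : ℚ), hab', one_smul]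
  refine ⟨a • s + b • y, M.add_mem (M.smul_mem _ hsM) (M.smul_mem _ hyM), ?_, fun v hv => ?_⟩
  · rw [← Int.cast_smul_eq_zsmul ℚ a, ← Int.cast_smul_eq_zsmul ℚ b]
    exact Submodule.add_mem _ (Submodule.smul_mem _ _ hsV) (Submodule.smul_mem _ _ hyV)
  · have hp0 : (p : ℚ) ≠ 0 := Nat.cast_ne_zero.mpr hp.ne_zero
    have h := hs v hv
    rw [hps, QuadraticMap.polar_smul_left, smul_eq_mul] at h
    exact (mul_left_cancel₀ hp0 h).symm

/-- If the projection to the fixed space does not preserve `M`, then `p` divides `det(T) A(M, T)`: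
either there is no fixed representation of `T`, or `p` divides `det (2T)`. -/
theorem congruentZeroMod_of_not_projectsToFixedLattice [FiniteDimensional ℚ V] (hQ : Q.PosDef)
    (hM : Submodule.span ℚ (M : Set V) = ⊤) (hint : IsIntegral Q M) {p : ℕ} (hp : p.Prime)
    (hodd : Odd p) (hσ : σ ∈ latticeIsometryGroup Q M) (hord : orderOf σ = p) {n : ℕ}
    (hn : Module.finrank ℚ (fixedSpace σ) = n) (hproj : ¬ ProjectsToFixedLattice Q M σ) :
    CongruentZeroMod p (thetaOperator (thetaCoeff Q M (n := n))) := by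
  intro T
  obtain ⟨G, hG, hdet⟩ := T.exists_det_eq
  have hp2 : ¬ (p : ℤ) ∣ 2 ^ n := fun h => by
    have h2 : p ∣ 2 := hp.dvd_of_dvd_pow (by exact_mod_cast h)
    rw [(Nat.prime_dvd_prime_iff_eq hp Nat.prime_two).mp h2] at hodd
    exact absurd hodd (by decide)
  have hdet' : T.1.det = G.det / 2 ^ n := by
    rw [hdet]
    field_simp
  suffices h : (p : ℤ) ∣ G.det * (representations Q M T).ncard by
    obtain ⟨k, hk⟩ := h
    refine ⟨k, 2 ^ n, hp2, ?_⟩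
    have hk' : (G.det * (representations Q M T).ncard : ℚ) = p * k := by exact_mod_cast hk
    rw [thetaOperator, thetaCoeff, hdet', div_mul_eq_mul_div, hk']
    push_cast
    ring
  by_contra hnd
  refine hproj ?_
  obtain ⟨x, hx, hxf⟩ : ∃ x ∈ representations Q M T, ∀ i, (x i : V) ∈ fixedSpace σ := by
    by_contra! h
    have hA := prime_dvd_ncard_representations hp hσ hord T (finite_representations hQ hM hint T) h
    exact hnd ((Int.natCast_dvd_natCast.mpr hA).mul_left _)
  refine projectsToFixedLattice_of_not_dvd_det hQ hint hp hσ hord hn (fun i => (x i).2) hxf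
    (fun i j => ?_) fun h => hnd (h.mul_right _)
  rw [hG, ← (show halfGram Q (fun i => (x i : V)) = T.1 from hx), halfGram, Matrix.of_apply]
  ring

/-- The lattice of vectors of `M` fixed by `σ`, as a lattice in the fixed space. -/
def fixedLattice (M : Submodule ℤ V) (σ : V ≃ₗ[ℚ] V) : Submodule ℤ (fixedSpace σ) :=
  M.comap ((fixedSpace σ).subtype.restrictScalars ℤ)

theorem isLattice_fixedLattice (hM : Submodule.IsLattice ℚ M) :
    Submodule.IsLattice ℚ (fixedLattice M σ) where
  fg := by
    have : IsNoetherian ℤ M := isNoetherian_of_fg_of_noetherian M hM.fg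
    have : IsNoetherian ℤ ((fixedLattice M σ).map ((fixedSpace σ).subtype.restrictScalars ℤ)) :=
      isNoetherian_of_le (Submodule.map_comap_le _ M)
    exact Submodule.fg_of_fg_map_injective ((fixedSpace σ).subtype.restrictScalars ℤ)
      (fixedSpace σ).injective_subtype (Submodule.FG.of_finite)
  span_eq_top := by
    refine eq_top_iff.mpr fun v _ => ?_
    obtain ⟨k, hk, hkv⟩ := exists_int_smul_mem hM.span_eq_top (v : V)
    have hv : v = (k : ℚ)⁻¹ • (k • v) := by
      rw [← Int.cast_smul_eq_zsmul ℚ, smul_smul, inv_mul_cancel₀ (Int.cast_ne_zero.mpr hk),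
        one_smul]
    rw [hv]
    exact Submodule.smul_mem _ _ (Submodule.subset_span hkv)

/-- If the projection to the fixed space preserves the unimodular lattice `M`, then the fixed
lattice is again even unimodular, so its rank is divisible by eight. -/
theorem eight_dvd_finrank_fixedSpace [FiniteDimensional ℚ V] (hQ : Q.PosDef)
    (hM : Submodule.IsLattice ℚ M) (hint : IsIntegral Q M) (huni : IsUnimodular Q M)
    (hproj : ProjectsToFixedLattice Q M σ) : 8 ∣ Module.finrank ℚ (fixedSpace σ) := by
  refine eight_dvd_finrank (Q := Q.comp (fixedSpace σ).subtype) (M := fixedLattice M σ)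
    (fun v hv => hQ v (by simpa using hv)) (isLattice_fixedLattice hM).span_eq_top
    (fun v hv => hint v hv) fun v hv => ?_
  have hpol : ∀ w : fixedSpace σ, QuadraticMap.polar (Q.comp (fixedSpace σ).subtype) v w =
      QuadraticMap.polar Q (v : V) w := fun w => rfl
  change (v : V) ∈ M
  rw [← huni, LinearMap.BilinForm.mem_dualSubmodule]
  intro m hm
  obtain ⟨m', hm'M, hm'V, hm'⟩ := hproj m hm
  obtain ⟨k, hk⟩ := hv ⟨m', hm'V⟩ hm'M
  rw [QuadraticMap.polarBilin_apply_apply, QuadraticMap.polar_comm, hm' v v.2,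
    QuadraticMap.polar_comm]
  rw [hpol] at hk
  exact Submodule.mem_one.mpr ⟨k, by rw [hk]; simp⟩

theorem isOrthogonalSum_fixedLattice (hQ : Q.PosDef) (hproj : ProjectsToFixedLattice Q M σ) :
    IsOrthogonalSum Q M ((fixedLattice M σ).map ((fixedSpace σ).subtype.restrictScalars ℤ))
      (M ⊓ (LinearMap.BilinForm.orthogonal (QuadraticMap.polarBilin Q)
        (fixedSpace σ)).restrictScalars ℤ) where
  sup_eq := by
    refine le_antisymm (sup_le (Submodule.map_comap_le _ M) inf_le_left) fun m hm => ?_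
    obtain ⟨m', hm'M, hm'V, hm'⟩ := hproj m hm
    refine Submodule.mem_sup.mpr ⟨m', ⟨⟨m', hm'V⟩, hm'M, rfl⟩, m - m', ⟨M.sub_mem hm hm'M, ?_⟩,
      add_sub_cancel m' m⟩
    refine LinearMap.BilinForm.mem_orthogonal_iff.mpr fun v hv => ?_
    rw [QuadraticMap.polarBilin_apply_apply, QuadraticMap.polar_comm, QuadraticMap.polar_sub_left,
      hm' v hv, sub_self]
  disjoint := by
    refine Submodule.disjoint_def.mpr ?_
    rintro _ ⟨v, -, rfl⟩ ⟨-, hv⟩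
    have hvv : QuadraticMap.polar Q (v : V) v = 0 := hv v v.2
    rw [QuadraticMap.polar_self, nsmul_eq_mul] at hvv
    by_contra hne
    have := hQ v hne
    norm_num at hvv
    simp [hvv] at this
  orthogonal := by
    rintro _ ⟨v, -, rfl⟩ y ⟨-, hy⟩
    exact hy v v.2

theorem finrank_map_fixedLattice (hM : Submodule.IsLattice ℚ M) :
    Module.finrank ℤ ((fixedLattice M σ).map ((fixedSpace σ).subtype.restrictScalars ℤ)) =
      Module.finrank ℚ (fixedSpace σ) := by
  have := isLattice_fixedLattice (σ := σ) hM
  rw [← (Submodule.equivMapOfInjective ((fixedSpace σ).subtype.restrictScalars ℤ)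
    (fixedSpace σ).injective_subtype (fixedLattice M σ)).finrank_eq]
  exact congrArg Cardinal.toNat (Submodule.IsLattice.rank' ℚ (fixedLattice M σ))

theorem isDecomposable_and_hasProperOrthogonalSummand [FiniteDimensional ℚ V] (hQ : Q.PosDef)
    (hM : Submodule.IsLattice ℚ M) (hσ : σ ≠ 1) (hpos : 1 ≤ Module.finrank ℚ (fixedSpace σ))
    (hproj : ProjectsToFixedLattice Q M σ) :
    IsDecomposable Q M ∧ HasProperOrthogonalSummand Q M (Module.finrank ℚ (fixedSpace σ)) := by
  have hsum := isOrthogonalSum_fixedLattice hQ hproj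
  have hL : (fixedLattice M σ).map ((fixedSpace σ).subtype.restrictScalars ℤ) ≠ M := by
    intro h
    refine hσ (LinearEquiv.ext fun x => ?_)
    have hle : Submodule.span ℚ (M : Set V) ≤ fixedSpace σ := by
      rw [Submodule.span_le, ← h]
      rintro _ ⟨v, -, rfl⟩
      exact v.2
    rw [hM.span_eq_top] at hle
    exact mem_fixedSpace.mp (hle Submodule.mem_top)
  refine ⟨⟨_, _, hsum, hL, fun h => ?_⟩, ⟨_, _, hsum, hL, finrank_map_fixedLattice hM⟩⟩
  -- if the second summand were `M`, the first would be zero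
  have hbot : (fixedLattice M σ).map ((fixedSpace σ).subtype.restrictScalars ℤ) = ⊥ := by
    have hd := hsum.disjoint
    rw [h] at hd
    exact disjoint_self.mp (hd.mono_right (Submodule.map_comap_le _ M))
  have h0 := finrank_map_fixedLattice (σ := σ) hM
  rw [hbot, finrank_bot] at h0
  omega

end FixedLattice

end SiegelTheta

theorem mainTheorem2 {V : Type*} [AddCommGroup V] [Module ℚ V] [FiniteDimensional ℚ V]
    (Q : QuadraticForm ℚ V) (hQ : Q.PosDef)
    (M : Submodule ℤ V) (hM : Submodule.IsLattice ℚ M)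
    (hint : SiegelTheta.IsIntegral Q M) (huni : SiegelTheta.IsUnimodular Q M)
    (p : ℕ) (hp : p.Prime) (hodd : Odd p)
    (σ : V ≃ₗ[ℚ] V) (hσ : σ ∈ SiegelTheta.latticeIsometryGroup Q M) (hord : orderOf σ = p)
    (m₀ : ℕ) (hm₀ : Module.finrank ℚ (SiegelTheta.fixedSpace σ) = m₀) (hpos : 1 ≤ m₀) :
    -- the theta series converges absolutely, and its coefficients are the numbers `A(M, T)`
    (∀ Z ∈ SiegelTheta.siegelUpperHalfSpace m₀, Summable fun x : Fin m₀ → M =>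
      SiegelTheta.expTrace (SiegelTheta.halfGram Q fun i => (x i : V)) Z) ∧
    (∀ T : SiegelTheta.HalfIntegralMatrix m₀, (SiegelTheta.representations Q M T).Finite) ∧
    SiegelTheta.HasFourierExpansion (SiegelTheta.thetaSeries Q M m₀)
      (SiegelTheta.thetaCoeff Q M) ∧
    -- the congruence, unless `M` is decomposable with a proper orthogonal summand of rank `m₀`
    (¬ (SiegelTheta.IsDecomposable Q M ∧ SiegelTheta.HasProperOrthogonalSummand Q M m₀) →
      SiegelTheta.CongruentZeroMod p
        (SiegelTheta.thetaOperator (SiegelTheta.thetaCoeff Q M (n := m₀)))) ∧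
    -- in particular it holds when `8` does not divide `m₀`
    (¬ 8 ∣ m₀ →
      SiegelTheta.CongruentZeroMod p
        (SiegelTheta.thetaOperator (SiegelTheta.thetaCoeff Q M (n := m₀)))) := by
  have hspan := hM.span_eq_top
  have hσ1 : σ ≠ 1 := by
    rintro rfl
    rw [orderOf_one] at hord
    exact hp.ne_one hord.symm
  refine ⟨fun Z hZ => (SiegelTheta.summable_norm_expTrace_halfGram hQ hspan hint hZ).of_norm,
    SiegelTheta.finite_representations hQ hspan hint,
    SiegelTheta.hasFourierExpansion_thetaSeries hQ hspan hint m₀, fun h => ?_, fun h => ?_⟩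
  · refine SiegelTheta.congruentZeroMod_of_not_projectsToFixedLattice hQ hspan hint hp hodd hσ
      hord hm₀ fun hproj => h ?_
    subst hm₀
    exact SiegelTheta.isDecomposable_and_hasProperOrthogonalSummand hQ hM hσ1 hpos hproj
  · refine SiegelTheta.congruentZeroMod_of_not_projectsToFixedLattice hQ hspan hint hp hodd hσ
      hord hm₀ fun hproj => h ?_
    subst hm₀
    exact SiegelTheta.eight_dvd_finrank_fixedSpace hQ hM hint huni hproj
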